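/- Let $n\ge 1$ and let $X_1,\dots,X_n,Y_1,\dots,Y_n,\Theta_1,\dots,\Theta_n,\Delta_1,\dots,\Delta_n$ be real random variables on one probability space. All bivariate limits are taken as $x\wedge y:=\min\{x,y\}\to\infty$, and $f\sim g$ means $f/g\to1$ in this limit. Definitions. The distribution of $X$ is in $\mathcal L$ if $\mathbb P[X>x-a]/\mathbb P[X>x]\to 1$ as $x\to\infty$ for every $a>0$. It is in $\mathcal D$ if $\mathbb P[X>x]>0$ for all $x$ and $\limsup_{x\to\infty}\mathbb P[X>bx]/\mathbb P[X>x]<\infty$ for every $b\in(0,1)$. A pair $(X,Y)$ is in $\mathcal L^{(2)}$ if both marginals are in $\mathcal L$ and $\mathbb P[X>x-a_1,Y>y-a_2]/\mathbb P[X>x,Y>y]\to1$ as $x\wedge y\to\infty$ for every $(a_1,a_2)\in[0,\infty)^2\setminus\{(0,0)\}$. It is in $\mathcal D^{(2)}$ if both marginals are in $\mathcal D$, $\mathbb P[X>x,Y>y]>0$ for all $x,y$, and $\limsup_{x\wedge y\to\infty}\mathbb P[X>b_1x,Y>b_2y]/\mathbb P[X>x,Y>y]<\infty$ for every $(b_1,b_2)\in(0,1)^2$.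 Put $(\mathcal D\cap\mathcal L)^{(2)}:=\mathcal D^{(2)}\cap\mathcal L^{(2)}$. Variables $X_1,\dots,X_n$ are TAI if $\mathbb P[|X_i|>x_i\mid X_j>x_j]\to0$ as $x_i\wedge x_j\to\infty$ for all $i\ne j$. Variables $X_1,\dots,X_n,Y_1,\dots,Y_n$ are GTAI if $\mathbb P[|X_i|>x_i\mid X_k>x_k,\,Y_j>y_j]\to0$ as $\min\{x_i,x_k,y_j\}\to\infty$ for all $i\neq k$ and all $j$, and $\mathbb P[|Y_j|>y_j\mid X_i>x_i,\,Y_k>y_k]\to0$ as $\min\{x_i,y_k,y_j\}\to\infty$ for all $j\ne k$ and all $i$. Theorem. Suppose that all $X_k$ and all $Y_l$ have distributions in $\mathcal D\cap\mathcal L$, that $X_1,\dots,X_n,Y_1,\dots,Y_n$ are GTAI, and that $(X_k,Y_l)\in(\mathcal D\cap\mathcal L)^{(2)}$ for all $k,l$. Suppose that there are constants $0<\xi_k\le\delta_k$ and $0<\gamma_l\le\zeta_l$ with $\xi_k\le\Theta_k\le\delta_k$ and $\gamma_l\le\Delta_l\le\zeta_l$ almost surely for all $k,l$, and that the vector $(\Theta_1,\dots,\Theta_n,\Delta_1,\dots,\Delta_n)$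 is independent of $(X_1,\dots,X_n,Y_1,\dots,Y_n)$ (the discount factors may depend on each other arbitrarily). Then $\Theta_1X_1,\dots,\Theta_nX_n,\Delta_1Y_1,\dots,\Delta_nY_n$ are GTAI, and $(\Theta_kX_k,\Delta_lY_l)\in(\mathcal D\cap\mathcal L)^{(2)}$ for all $k,l$. If moreover $X_1,\dots,X_n$ are TAI and $Y_1,\dots,Y_n$ are TAI, then, as $x\wedge y\to\infty$, $$\mathbb P\Big[\sum_{k=1}^n\Theta_kX_k>x,\ \sum_{l=1}^n\Delta_lY_l>y\Big]\sim\mathbb P\Big[\max_{1\le i\le n}\sum_{k=1}^i\Theta_kX_k>x,\ \max_{1\le j\le n}\sum_{l=1}^j\Delta_lY_l>y\Big]$$ $$\sim\mathbb P\Big[\max_{1\le k\le n}\Theta_kX_k>x,\ \max_{1\le l\le n}\Delta_lY_l>y\Big]\sim\sum_{k=1}^n\sum_{l=1}^n\mathbb P[\Theta_kX_k>x,\ \Delta_lY_l>y].$$ -/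

import Mathlib

open MeasureTheory ProbabilityTheory Filter Topology Asymptotics

/-- The tail `P[X > x]` of a random variable. -/
noncomputable def tail {Ω : Type*} [MeasurableSpace Ω] (μ : Measure Ω) (X : Ω → ℝ) (x : ℝ) : ℝ :=
  μ.real {ω | x < X ω}

/-- The joint tail `P[X > x, Y > y]` of a random pair. -/
noncomputable def jointTail {Ω : Type*} [MeasurableSpace Ω] (μ : Measure Ω) (X Y : Ω → ℝ)
    (x y : ℝ) : ℝ :=
  μ.real {ω | x < X ω ∧ y < Y ω}

/-- The class `𝓛` of long-tailed distributions: `P[X > x - a] / P[X > x] → 1` as `x → ∞`,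
for every `a > 0`. (The limit being `1` forces `P[X > x] > 0` for all `x`.) -/
def LongTailed {Ω : Type*} [MeasurableSpace Ω] (μ : Measure Ω) (X : Ω → ℝ) : Prop :=
  ∀ a : ℝ, 0 < a → Tendsto (fun x : ℝ => tail μ X (x - a) / tail μ X x) atTop (𝓝 1)

/-- The class `𝓓` of dominatedly varying distributions: the tail is positive everywhere and
`limsup_{x → ∞} P[X > b x] / P[X > x] < ∞` for every `b ∈ (0, 1)`. Finiteness of the limsup of
a nonnegative ratio is expressed as eventual boundedness above. -/
def DominatedlyVarying {Ω : Type*} [MeasurableSpace Ω] (μ : Measure Ω) (X : Ω → ℝ) : Prop :=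
  (∀ x : ℝ, 0 < tail μ X x) ∧
  ∀ b : ℝ, 0 < b → b < 1 →
    IsBoundedUnder (· ≤ ·) atTop (fun x : ℝ => tail μ X (b * x) / tail μ X x)

/-- The class `𝓛⁽²⁾` of bivariate long-tailed pairs. The filter `atTop ×ˢ atTop` on `ℝ × ℝ`
is the limit `min x y → ∞`; the vector `a = (a₁, a₂)` ranges over `[0, ∞)² \ {0}`. -/
def BivLongTailed {Ω : Type*} [MeasurableSpace Ω] (μ : Measure Ω) (X Y : Ω → ℝ) : Prop :=
  LongTailed μ X ∧ LongTailed μ Y ∧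
  ∀ a₁ a₂ : ℝ, 0 ≤ a₁ → 0 ≤ a₂ → (a₁, a₂) ≠ (0, 0) →
    Tendsto (fun p : ℝ × ℝ => jointTail μ X Y (p.1 - a₁) (p.2 - a₂) / jointTail μ X Y p.1 p.2)
      (atTop ×ˢ atTop) (𝓝 1)

/-- The class `𝓓⁽²⁾` of bivariate dominatedly varying pairs: the joint tail is positive
everywhere and `limsup P[X > b₁ x, Y > b₂ y] / P[X > x, Y > y] < ∞` as `min x y → ∞`,
for every `b ∈ (0, 1)²`. -/
def BivDominatedlyVarying {Ω : Type*} [MeasurableSpace Ω] (μ : Measure Ω) (X Y : Ω → ℝ) : Prop :=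
  DominatedlyVarying μ X ∧ DominatedlyVarying μ Y ∧
  (∀ x y : ℝ, 0 < jointTail μ X Y x y) ∧
  ∀ b₁ b₂ : ℝ, 0 < b₁ → b₁ < 1 → 0 < b₂ → b₂ < 1 →
    IsBoundedUnder (· ≤ ·) (atTop ×ˢ atTop)
      (fun p : ℝ × ℝ => jointTail μ X Y (b₁ * p.1) (b₂ * p.2) / jointTail μ X Y p.1 p.2)

/-- The class `(𝓓 ∩ 𝓛)⁽²⁾ = 𝓓⁽²⁾ ∩ 𝓛⁽²⁾`. -/
def BivDL {Ω : Type*} [MeasurableSpace Ω] (μ : Measure Ω) (X Y : Ω → ℝ) : Prop :=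
  BivDominatedlyVarying μ X Y ∧ BivLongTailed μ X Y

/-- Tail asymptotic independence: `P[|X_i| > x_i | X_j > x_j] → 0` as `min (x_i, x_j) → ∞`,
for all `i ≠ j`. -/
def TAI {Ω : Type*} [MeasurableSpace Ω] (μ : Measure Ω) {n : ℕ} (X : Fin n → Ω → ℝ) : Prop :=
  ∀ i j : Fin n, i ≠ j →
    Tendsto (fun p : ℝ × ℝ => (cond μ {ω | p.2 < X j ω}).real {ω | p.1 < |X i ω|})
      (atTop ×ˢ atTop) (𝓝 0)

/-- Generalized tail asymptotic independence of `X_1, …, X_n, Y_1, …, Y_m`. The three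
thresholds tend to infinity jointly. -/
def GTAI {Ω : Type*} [MeasurableSpace Ω] (μ : Measure Ω) {n m : ℕ}
    (X : Fin n → Ω → ℝ) (Y : Fin m → Ω → ℝ) : Prop :=
  (∀ (i k : Fin n) (j : Fin m), i ≠ k →
    Tendsto (fun p : ℝ × ℝ × ℝ =>
        (cond μ {ω | p.2.1 < X k ω ∧ p.2.2 < Y j ω}).real {ω | p.1 < |X i ω|})
      (atTop ×ˢ atTop ×ˢ atTop) (𝓝 0)) ∧
  (∀ (j k : Fin m) (i : Fin n), j ≠ k →
    Tendsto (fun p : ℝ × ℝ × ℝ =>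
        (cond μ {ω | p.2.1 < X i ω ∧ p.2.2 < Y k ω}).real {ω | p.1 < |Y j ω|})
      (atTop ×ˢ atTop ×ˢ atTop) (𝓝 0))

/-- The random variable `Θ` is almost surely bounded away from `0` and from `∞`. -/
def AEBoundedAway {Ω : Type*} [MeasurableSpace Ω] (μ : Measure Ω) (Θ : Ω → ℝ) : Prop :=
  ∃ ξ δ : ℝ, 0 < ξ ∧ ξ ≤ δ ∧ ∀ᵐ ω ∂μ, ξ ≤ Θ ω ∧ Θ ω ≤ δ

/-- The products `Θ_k X_k`. -/
def weighted {Ω : Type*} {n : ℕ} (Θ X : Fin n → Ω → ℝ) : Fin n → Ω → ℝ :=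
  fun k ω => Θ k ω * X k ω

/-- The sum `Z_1 + ⋯ + Z_n`. -/
def totalSum {Ω : Type*} {n : ℕ} (Z : Fin n → Ω → ℝ) : Ω → ℝ :=
  fun ω => ∑ k, Z k ω

/-- The maximum `max_{1 ≤ k ≤ n} Z_k`. -/
noncomputable def maxTerm {Ω : Type*} {n : ℕ} [NeZero n] (Z : Fin n → Ω → ℝ) : Ω → ℝ :=
  fun ω => Finset.univ.sup' Finset.univ_nonempty (fun k => Z k ω)

/-- The maximum `max_{1 ≤ i ≤ n} (Z_1 + ⋯ + Z_i)` of the partial sums. -/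
noncomputable def maxPartialSum {Ω : Type*} {n : ℕ} [NeZero n] (Z : Fin n → Ω → ℝ) : Ω → ℝ :=
  maxTerm (fun i ω => ∑ k ∈ Finset.Iic i, Z k ω)

/-- `P[U > x, V > y] ∼ ∑_k ∑_l P[Z_k > x, W_l > y]` as `min x y → ∞`. -/
def JointTailEquivDoubleSum {Ω : Type*} [MeasurableSpace Ω] (μ : Measure Ω) {n : ℕ}
    (U V : Ω → ℝ) (Z W : Fin n → Ω → ℝ) : Prop :=
  (fun p : ℝ × ℝ => jointTail μ U V p.1 p.2) ~[atTop ×ˢ atTop]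
    (fun p : ℝ × ℝ => ∑ k, ∑ l, jointTail μ (Z k) (W l) p.1 p.2)

/-! Each limit is rewritten as a one-sided inequality valid beyond a threshold; monotonicity of
tails supplies the other side.

Weights lying in compact subintervals of `(0, ∞)` sandwich the weighted joint tail between joint
tails of `(X, Y)` at rescaled thresholds. Dominated variation makes these comparable up to a
constant, which is enough to carry over dominated variation and GTAI (`JointDom.mul`,
`Negligible.mul`). Long-tailedness needs a ratio tending to 1, so there independence is used to
freeze the weights (`JointLong.mul`).

The asymptotics follow the principle of one big jump in each coordinate. If both functionals are
large, some `Z k` exceeds `x / n` and some `W l` exceeds `y / n`. Either all other terms are at most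
a constant `a`, and then `Z k > x - n * a` and `W l > y - n * a`, a bounded shift that
long-tailedness absorbs; or another term is large too, which is negligible by GTAI and dominated
variation (`eventually_jointTail_le`). Conversely, the events where exactly one pair jumps are
disjoint and carry almost the full double sum (`eventually_le_jointTail`). Only the two bounds in
`SingleJump` enter, and the sum, the maximum and the maximal partial sum all satisfy them. -/

section TailAsymptotics

/-! ### Limits as uniform inequalities beyond a threshold -/

variable {Ω : Type*} [MeasurableSpace Ω] {μ : Measure Ω}

/-- Uniform form of long-tailedness of a joint tail beyond a threshold. -/
def JointLong (μ : Measure Ω) (X Y : Ω → ℝ) : Prop :=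
  ∀ a : ℝ, 0 < a → ∀ ε : ℝ, 0 < ε → ∀ᶠ T : ℝ in atTop, ∀ x ≥ T, ∀ y ≥ T,
    jointTail μ X Y (x - a) (y - a) ≤ (1 + ε) * jointTail μ X Y x y

/-- Uniform form of dominated variation of a joint tail beyond a threshold. -/
def JointDom (μ : Measure Ω) (X Y : Ω → ℝ) : Prop :=
  ∀ b : ℝ, 0 < b → b < 1 → ∃ C : ℝ, 0 < C ∧ ∀ᶠ T : ℝ in atTop, ∀ x ≥ T, ∀ y ≥ T,
    jointTail μ X Y (b * x) (b * y) ≤ C * jointTail μ X Y x y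

/-- Large values of `|V|` are negligible given joint exceedances of `X` and `Y`. -/
def Negligible (μ : Measure Ω) (V X Y : Ω → ℝ) : Prop :=
  ∀ ε : ℝ, 0 < ε → ∀ᶠ T : ℝ in atTop, ∀ a ≥ T, ∀ x ≥ T, ∀ y ≥ T,
    μ.real ({ω | x < X ω ∧ y < Y ω} ∩ {ω | a < |V ω|}) ≤ ε * jointTail μ X Y x y

lemma eventually_atTop_prod_iff {P : ℝ × ℝ → Prop} :
    (∀ᶠ p in atTop ×ˢ atTop, P p) ↔ ∀ᶠ T : ℝ in atTop, ∀ x ≥ T, ∀ y ≥ T, P (x, y) := by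
  rw [prod_atTop_atTop_eq, eventually_atTop]
  constructor
  · rintro ⟨⟨a, b⟩, h⟩
    filter_upwards [eventually_ge_atTop a, eventually_ge_atTop b] with T ha hb x hx y hy
    exact h (x, y) ⟨ha.trans hx, hb.trans hy⟩
  · intro h
    obtain ⟨T, hT⟩ := h.exists
    exact ⟨(T, T), fun p hp => hT p.1 hp.1 p.2 hp.2⟩

lemma eventually_atTop_prod_prod_iff {P : ℝ × ℝ × ℝ → Prop} :
    (∀ᶠ p in atTop ×ˢ atTop ×ˢ atTop, P p) ↔
      ∀ᶠ T : ℝ in atTop, ∀ a ≥ T, ∀ x ≥ T, ∀ y ≥ T, P (a, x, y) := by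
  rw [prod_atTop_atTop_eq, prod_atTop_atTop_eq, eventually_atTop]
  constructor
  · rintro ⟨⟨a, b, c⟩, h⟩
    filter_upwards [eventually_ge_atTop a, eventually_ge_atTop b, eventually_ge_atTop c]
      with T ha hb hc u hu x hx y hy
    exact h (u, x, y) ⟨ha.trans hu, hb.trans hx, hc.trans hy⟩
  · intro h
    obtain ⟨T, hT⟩ := h.exists
    exact ⟨(T, T, T), fun p hp => hT p.1 hp.1 p.2.1 hp.2.1 p.2.2 hp.2.2⟩

lemma jointTail_nonneg (X Y : Ω → ℝ) (x y : ℝ) : 0 ≤ jointTail μ X Y x y := measureReal_nonneg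

lemma jointTail_anti [IsFiniteMeasure μ] (X Y : Ω → ℝ) {x x' y y' : ℝ} (hx : x ≤ x')
    (hy : y ≤ y') : jointTail μ X Y x' y' ≤ jointTail μ X Y x y :=
  measureReal_mono fun _ h => ⟨hx.trans_lt h.1, hy.trans_lt h.2⟩

/-- Makes the univariate classes the diagonal case of the bivariate ones, so that each closure
property is proved only once. -/
lemma jointTail_self (X : Ω → ℝ) (x y : ℝ) : jointTail μ X X x y = tail μ X (max x y) := by
  simp only [jointTail, tail, max_lt_iff]

lemma jointLong_iff [IsFiniteMeasure μ] {X Y : Ω → ℝ} (hpos : ∀ x y, 0 < jointTail μ X Y x y) :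
    (∀ a₁ a₂ : ℝ, 0 ≤ a₁ → 0 ≤ a₂ → (a₁, a₂) ≠ (0, 0) →
      Tendsto (fun p : ℝ × ℝ => jointTail μ X Y (p.1 - a₁) (p.2 - a₂) / jointTail μ X Y p.1 p.2)
        (atTop ×ˢ atTop) (𝓝 1)) ↔ JointLong μ X Y := by
  constructor
  · intro h a ha ε hε
    have h1 := (h a a ha.le ha.le (by simp [ha.ne'])).eventually_le_const
      (show (1 : ℝ) < 1 + ε by linarith)
    rw [eventually_atTop_prod_iff] at h1
    filter_upwards [h1] with T hT x hx y hy
    exact (div_le_iff₀ (hpos x y)).1 (hT x hx y hy)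
  · intro h a₁ a₂ h₁ h₂ _
    rw [tendsto_order]
    -- A common shift dominating both; the extra 1 makes it positive at once.
    have ha : 0 < max a₁ a₂ + 1 := by positivity
    constructor
    · intro c hc
      refine Eventually.of_forall fun p => hc.trans_le ?_
      rw [le_div_iff₀ (hpos _ _), one_mul]
      exact jointTail_anti X Y (by linarith) (by linarith)
    · intro c hc
      rw [eventually_atTop_prod_iff]
      filter_upwards [h _ ha ((c - 1) / 2) (by linarith)] with T hT x hx y hy
      rw [div_lt_iff₀ (hpos _ _)]
      have h3 := jointTail_anti (μ := μ) X Y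
        (show x - (max a₁ a₂ + 1) ≤ x - a₁ by linarith [le_max_left a₁ a₂])
        (show y - (max a₁ a₂ + 1) ≤ y - a₂ by linarith [le_max_right a₁ a₂])
      nlinarith [hT x hx y hy, hpos x y]

lemma jointDom_iff [IsFiniteMeasure μ] {X Y : Ω → ℝ} (hpos : ∀ x y, 0 < jointTail μ X Y x y) :
    (∀ b₁ b₂ : ℝ, 0 < b₁ → b₁ < 1 → 0 < b₂ → b₂ < 1 →
      IsBoundedUnder (· ≤ ·) (atTop ×ˢ atTop)
        (fun p : ℝ × ℝ => jointTail μ X Y (b₁ * p.1) (b₂ * p.2) / jointTail μ X Y p.1 p.2)) ↔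
      JointDom μ X Y := by
  constructor
  · intro h b hb hb'
    obtain ⟨C, hC⟩ := h b b hb hb' hb hb'
    rw [eventually_map, eventually_atTop_prod_iff] at hC
    refine ⟨max C 1, by positivity, ?_⟩
    filter_upwards [hC] with T hT x hx y hy
    exact (div_le_iff₀ (hpos x y)).1 ((hT x hx y hy).trans (le_max_left _ _))
  · intro h b₁ b₂ h₁ h₁' h₂ h₂'
    obtain ⟨C, _, hC⟩ := h (min b₁ b₂) (lt_min h₁ h₂) (min_lt_of_left_lt h₁')
    refine ⟨C, ?_⟩
    rw [eventually_map, eventually_atTop_prod_iff]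
    filter_upwards [hC, eventually_ge_atTop 0] with T hT hT0 x hx y hy
    rw [div_le_iff₀ (hpos _ _)]
    refine (jointTail_anti X Y ?_ ?_).trans (hT x hx y hy)
    · exact mul_le_mul_of_nonneg_right (min_le_left _ _) (hT0.trans hx)
    · exact mul_le_mul_of_nonneg_right (min_le_right _ _) (hT0.trans hy)

lemma longTailed_iff [IsFiniteMeasure μ] {X : Ω → ℝ} (hpos : ∀ x, 0 < tail μ X x) :
    LongTailed μ X ↔ JointLong μ X X := by
  have hpos' : ∀ x y, 0 < jointTail μ X X x y := fun x y => by
    rw [jointTail_self]; exact hpos _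
  constructor
  · intro h a ha ε hε
    obtain ⟨S, hS⟩ := eventually_atTop.1 ((h a ha).eventually_le_const
      (show (1 : ℝ) < 1 + ε by linarith))
    filter_upwards [eventually_ge_atTop S] with T hT x hx y hy
    rw [jointTail_self, jointTail_self, max_sub_sub_right]
    exact (div_le_iff₀ (hpos _)).1 (hS _ (le_max_of_le_left (hT.trans hx)))
  · intro h a ha
    have h1 := (jointLong_iff hpos').2 h a a ha.le ha.le (by simp [ha.ne'])
    simpa [Function.comp_def, jointTail_self] using
      h1.comp (tendsto_id.prodMk (tendsto_id (x := (atTop : Filter ℝ))))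

lemma dominatedlyVarying_iff [IsFiniteMeasure μ] {X : Ω → ℝ} :
    DominatedlyVarying μ X ↔ (∀ x y, 0 < jointTail μ X X x y) ∧ JointDom μ X X := by
  constructor
  · rintro ⟨hpos, h⟩
    refine ⟨fun x y => by rw [jointTail_self]; exact hpos _, fun b hb hb' => ?_⟩
    obtain ⟨C, hC⟩ := h b hb hb'
    obtain ⟨S, hS⟩ := eventually_atTop.1 (eventually_map.1 hC)
    refine ⟨max C 1, by positivity, ?_⟩
    filter_upwards [eventually_ge_atTop S] with T hT x hx y hy
    rw [jointTail_self, jointTail_self, ← mul_max_of_nonneg _ _ hb.le]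
    exact (div_le_iff₀ (hpos _)).1
      ((hS _ (le_max_of_le_left (hT.trans hx))).trans (le_max_left _ _))
  · rintro ⟨hpos, h⟩
    have hpos' : ∀ x, 0 < tail μ X x := fun x => by simpa [jointTail_self] using hpos x x
    refine ⟨hpos', fun b hb hb' => ?_⟩
    obtain ⟨C, _, hC⟩ := h b hb hb'
    obtain ⟨T, hT⟩ := hC.exists
    refine ⟨C, eventually_map.2 ?_⟩
    filter_upwards [eventually_ge_atTop T] with x hx
    rw [div_le_iff₀ (hpos' _)]
    simpa [jointTail_self] using hT x hx x hx

lemma bivDL_iff [IsFiniteMeasure μ] {X Y : Ω → ℝ} :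
    BivDL μ X Y ↔ (DominatedlyVarying μ X ∧ LongTailed μ X) ∧
      (DominatedlyVarying μ Y ∧ LongTailed μ Y) ∧
      (∀ x y, 0 < jointTail μ X Y x y) ∧ JointDom μ X Y ∧ JointLong μ X Y := by
  constructor
  · rintro ⟨⟨h1, h2, h3, h4⟩, h5, h6, h7⟩
    exact ⟨⟨h1, h5⟩, ⟨h2, h6⟩, h3, (jointDom_iff h3).1 h4, (jointLong_iff h3).1 h7⟩
  · rintro ⟨⟨h1, h5⟩, ⟨h2, h6⟩, h3, h4, h7⟩
    exact ⟨⟨h1, h2, h3, (jointDom_iff h3).2 h4⟩, h5, h6, (jointLong_iff h3).2 h7⟩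

lemma negligible_iff [IsFiniteMeasure μ] {V X Y : Ω → ℝ} (hX : Measurable X) (hY : Measurable Y)
    (hpos : ∀ x y, 0 < jointTail μ X Y x y) :
    Tendsto (fun p : ℝ × ℝ × ℝ =>
        (cond μ {ω | p.2.1 < X ω ∧ p.2.2 < Y ω}).real {ω | p.1 < |V ω|})
      (atTop ×ˢ atTop ×ˢ atTop) (𝓝 0) ↔ Negligible μ V X Y := by
  have key : ∀ p : ℝ × ℝ × ℝ, (cond μ {ω | p.2.1 < X ω ∧ p.2.2 < Y ω}).real {ω | p.1 < |V ω|} =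
      μ.real ({ω | p.2.1 < X ω ∧ p.2.2 < Y ω} ∩ {ω | p.1 < |V ω|}) /
        jointTail μ X Y p.2.1 p.2.2 := by
    intro p
    have hm : MeasurableSet {ω | p.2.1 < X ω ∧ p.2.2 < Y ω} :=
      (measurableSet_lt measurable_const hX).inter (measurableSet_lt measurable_const hY)
    rw [measureReal_def, cond_apply hm, ENNReal.toReal_mul, ENNReal.toReal_inv, div_eq_inv_mul]
    rfl
  simp only [key]
  constructor
  · intro h ε hε
    have h1 := h.eventually_le_const hε
    rw [eventually_atTop_prod_prod_iff] at h1
    filter_upwards [h1] with T hT a ha x hx y hy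
    exact (div_le_iff₀ (hpos x y)).1 (hT a ha x hx y hy)
  · intro h
    rw [tendsto_order]
    constructor
    · intro c hc
      exact Eventually.of_forall fun p => hc.trans_le
        (div_nonneg measureReal_nonneg (jointTail_nonneg _ _ _ _))
    · intro c hc
      rw [eventually_atTop_prod_prod_iff]
      filter_upwards [h (c / 2) (by linarith)] with T hT a ha x hx y hy
      rw [div_lt_iff₀ (hpos _ _)]
      nlinarith [hT a ha x hx y hy, hpos x y]

/-! ### Random weights -/

/-- A nonnegative threshold forces `v > 0`, and only then is `θ * v` monotone in `θ`. -/
lemma lt_div_of_lt_mul_of_le {θ δ v x : ℝ} (hx : 0 ≤ x) (hθ : 0 < θ) (hδ : θ ≤ δ)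
    (h : x < θ * v) : x / δ < v := by
  have hv : 0 < v := by
    by_contra! hv
    nlinarith
  rw [div_lt_iff₀ (hθ.trans_le hδ)]
  nlinarith

lemma lt_mul_of_div_lt_of_le {θ ξ v x : ℝ} (hx : 0 ≤ x) (hξ : 0 < ξ) (hθ : ξ ≤ θ)
    (h : x / ξ < v) : x < θ * v := by
  have hv : 0 < v := (div_nonneg hx hξ.le).trans_lt h
  rw [div_lt_iff₀ hξ] at h
  nlinarith

lemma jointTail_mul_le [IsFiniteMeasure μ] {X Y Θ Δ : Ω → ℝ} {ξ δ γ ζ : ℝ} (hξ : 0 < ξ)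
    (hγ : 0 < γ) (hΘ : ∀ᵐ ω ∂μ, ξ ≤ Θ ω ∧ Θ ω ≤ δ) (hΔ : ∀ᵐ ω ∂μ, γ ≤ Δ ω ∧ Δ ω ≤ ζ)
    {x y : ℝ} (hx : 0 ≤ x) (hy : 0 ≤ y) :
    jointTail μ (fun ω => Θ ω * X ω) (fun ω => Δ ω * Y ω) x y ≤
      jointTail μ X Y (x / δ) (y / ζ) := by
  refine ENNReal.toReal_mono (measure_ne_top _ _) (measure_mono_ae ?_)
  filter_upwards [hΘ, hΔ] with ω h1 h2 h
  exact ⟨lt_div_of_lt_mul_of_le hx (hξ.trans_le h1.1) h1.2 h.1,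
    lt_div_of_lt_mul_of_le hy (hγ.trans_le h2.1) h2.2 h.2⟩

lemma le_jointTail_mul [IsFiniteMeasure μ] {X Y Θ Δ : Ω → ℝ} {ξ δ γ ζ : ℝ} (hξ : 0 < ξ)
    (hγ : 0 < γ) (hΘ : ∀ᵐ ω ∂μ, ξ ≤ Θ ω ∧ Θ ω ≤ δ) (hΔ : ∀ᵐ ω ∂μ, γ ≤ Δ ω ∧ Δ ω ≤ ζ)
    {x y : ℝ} (hx : 0 ≤ x) (hy : 0 ≤ y) :
    jointTail μ X Y (x / ξ) (y / γ) ≤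
      jointTail μ (fun ω => Θ ω * X ω) (fun ω => Δ ω * Y ω) x y := by
  refine ENNReal.toReal_mono (measure_ne_top _ _) (measure_mono_ae ?_)
  filter_upwards [hΘ, hΔ] with ω h1 h2 h
  exact ⟨lt_mul_of_div_lt_of_le hx hξ h1.1 h.1, lt_mul_of_div_lt_of_le hy hγ h2.1 h.2⟩

lemma jointTail_mul_pos [IsFiniteMeasure μ] {X Y Θ Δ : Ω → ℝ} (hΘ : AEBoundedAway μ Θ)
    (hΔ : AEBoundedAway μ Δ) (hpos : ∀ x y, 0 < jointTail μ X Y x y) (x y : ℝ) :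
    0 < jointTail μ (fun ω => Θ ω * X ω) (fun ω => Δ ω * Y ω) x y := by
  obtain ⟨ξ, δ, hξ, _, hΘ⟩ := hΘ
  obtain ⟨γ, ζ, hγ, _, hΔ⟩ := hΔ
  -- The sandwich needs nonnegative thresholds, hence the maxima with 0.
  exact (hpos _ _).trans_le ((le_jointTail_mul hξ hγ hΘ hΔ (le_max_right x 0)
    (le_max_right y 0)).trans (jointTail_anti _ _ (le_max_left _ _) (le_max_left _ _)))

/-- Dominated variation absorbs arbitrary rescalings. -/
lemma JointDom.rescale [IsFiniteMeasure μ] {X Y : Ω → ℝ} (h : JointDom μ X Y)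
    {c d c' d' : ℝ} (hc : 0 < c) (hd : 0 < d) (hc' : 0 < c') (hd' : 0 < d') :
    ∃ C : ℝ, 0 < C ∧ ∀ᶠ T : ℝ in atTop, ∀ x ≥ T, ∀ y ≥ T,
      jointTail μ X Y (x / c) (y / d) ≤ C * jointTail μ X Y (x / c') (y / d') := by
  -- The bounds `c' / c` and `d' / d` give `b * (x / c') ≤ x / c` and its analogue in `y`; `1 / 2`
  -- keeps `b < 1`.
  set b : ℝ := min (1 / 2) (min (c' / c) (d' / d)) with hb
  have hb0 : 0 < b := by positivity
  obtain ⟨C, hC, h1⟩ := h b hb0 ((min_le_left _ _).trans_lt (by norm_num))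
  obtain ⟨S, hS⟩ := h1.exists
  refine ⟨C, hC, ?_⟩
  filter_upwards [eventually_ge_atTop 0, eventually_ge_atTop (S * c'),
    eventually_ge_atTop (S * d')] with T h0 h2 h3 x hx y hy
  refine (jointTail_anti X Y ?_ ?_).trans
    (hS (x / c') ((le_div_iff₀ hc').2 (h2.trans hx)) (y / d') ((le_div_iff₀ hd').2 (h3.trans hy)))
  · calc b * (x / c') ≤ c' / c * (x / c') :=
        mul_le_mul_of_nonneg_right ((min_le_right _ _).trans (min_le_left _ _))
          (div_nonneg (h0.trans hx) hc'.le)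
      _ = x / c := by field_simp
  · calc b * (y / d') ≤ d' / d * (y / d') :=
        mul_le_mul_of_nonneg_right ((min_le_right _ _).trans (min_le_right _ _))
          (div_nonneg (h0.trans hy) hd'.le)
      _ = y / d := by field_simp

/-- The sandwich costs only a constant factor, so the weights may depend on `X` and `Y` here. -/
lemma JointDom.mul [IsFiniteMeasure μ] {X Y Θ Δ : Ω → ℝ} (h : JointDom μ X Y)
    (hΘ : AEBoundedAway μ Θ) (hΔ : AEBoundedAway μ Δ) :
    JointDom μ (fun ω => Θ ω * X ω) (fun ω => Δ ω * Y ω) := by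
  obtain ⟨ξ, δ, hξ, hδ, hΘ⟩ := hΘ
  obtain ⟨γ, ζ, hγ, hζ, hΔ⟩ := hΔ
  intro b hb _
  have hδ0 := hξ.trans_le hδ
  have hζ0 := hγ.trans_le hζ
  obtain ⟨C, hC, h1⟩ := h.rescale (div_pos hδ0 hb) (div_pos hζ0 hb) hξ hγ
  refine ⟨C, hC, ?_⟩
  filter_upwards [h1, eventually_ge_atTop 0] with T hT h0 x hx y hy
  have hx0 := h0.trans hx
  have hy0 := h0.trans hy
  calc _ ≤ jointTail μ X Y (b * x / δ) (b * y / ζ) :=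
        jointTail_mul_le hξ hγ hΘ hΔ (by positivity) (by positivity)
    _ = jointTail μ X Y (x / (δ / b)) (y / (ζ / b)) := by
        congr 1 <;> field_simp
    _ ≤ C * jointTail μ X Y (x / ξ) (y / γ) := hT x hx y hy
    _ ≤ _ := mul_le_mul_of_nonneg_left (le_jointTail_mul hξ hγ hΘ hΔ hx0 hy0) hC.le

lemma Negligible.mul [IsFiniteMeasure μ] {V X Y Ψ Θ Δ : Ω → ℝ} (h : Negligible μ V X Y)
    (hD : JointDom μ X Y) (hΨ : AEBoundedAway μ Ψ) (hΘ : AEBoundedAway μ Θ)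
    (hΔ : AEBoundedAway μ Δ) :
    Negligible μ (fun ω => Ψ ω * V ω) (fun ω => Θ ω * X ω) (fun ω => Δ ω * Y ω) := by
  obtain ⟨η, κ, hη, hκ, hΨ⟩ := hΨ
  obtain ⟨ξ, δ, hξ, hδ, hΘ⟩ := hΘ
  obtain ⟨γ, ζ, hγ, hζ, hΔ⟩ := hΔ
  have hδ0 := hξ.trans_le hδ
  have hζ0 := hγ.trans_le hζ
  have hκ0 := hη.trans_le hκ
  obtain ⟨C, hC, h1⟩ := hD.rescale hδ0 hζ0 hξ hγ
  intro ε hε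
  -- Dividing by `C` pays in advance for moving the thresholds from `x / δ`, `y / ζ` to `x / ξ`, `y
  -- / γ`.
  obtain ⟨S, hS⟩ := (h (ε / C) (by positivity)).exists
  filter_upwards [h1, eventually_ge_atTop 0, eventually_ge_atTop (S * κ),
    eventually_ge_atTop (S * δ), eventually_ge_atTop (S * ζ)] with T hT h0 h2 h3 h4 a ha x hx y hy
  have ha0 := h0.trans ha
  have hx0 := h0.trans hx
  have hy0 := h0.trans hy
  calc _ ≤ μ.real ({ω | x / δ < X ω ∧ y / ζ < Y ω} ∩ {ω | a / κ < |V ω|}) := by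
        refine ENNReal.toReal_mono (measure_ne_top _ _) (measure_mono_ae ?_)
        filter_upwards [hΨ, hΘ, hΔ] with ω e1 e2 e3 e
        refine ⟨⟨lt_div_of_lt_mul_of_le hx0 (hξ.trans_le e2.1) e2.2 e.1.1,
          lt_div_of_lt_mul_of_le hy0 (hγ.trans_le e3.1) e3.2 e.1.2⟩,
          lt_div_of_lt_mul_of_le ha0 (hη.trans_le e1.1) e1.2 ?_⟩
        have e4 : a < |Ψ ω * V ω| := e.2
        rwa [abs_mul, abs_of_pos (hη.trans_le e1.1)] at e4
    _ ≤ ε / C * jointTail μ X Y (x / δ) (y / ζ) :=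
        hS _ ((le_div_iff₀ hκ0).2 (h2.trans ha)) _ ((le_div_iff₀ hδ0).2 (h3.trans hx)) _
          ((le_div_iff₀ hζ0).2 (h4.trans hy))
    _ ≤ ε / C * (C * jointTail μ X Y (x / ξ) (y / γ)) :=
        mul_le_mul_of_nonneg_left (hT x hx y hy) (by positivity)
    _ = ε * jointTail μ X Y (x / ξ) (y / γ) := by field_simp
    _ ≤ _ := mul_le_mul_of_nonneg_left (le_jointTail_mul hξ hγ hΘ hΔ hx0 hy0) hε.le

/-- Comparison of probabilities section by section along an independent variable. -/
lemma measureReal_le_mul_of_sections [IsProbabilityMeasure μ] {α β : Type*} [MeasurableSpace α]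
    [MeasurableSpace β] {U : Ω → α} {V : Ω → β} (hU : Measurable U) (hV : Measurable V)
    (hUV : IndepFun U V μ) {A B : Set (α × β)} (hA : MeasurableSet A) (hB : MeasurableSet B)
    {c : ℝ} (hc : 0 ≤ c)
    (h : ∀ᵐ ω ∂μ, μ.real {ω' | (U ω, V ω') ∈ A} ≤ c * μ.real {ω' | (U ω, V ω') ∈ B}) :
    μ.real {ω | (U ω, V ω) ∈ A} ≤ c * μ.real {ω | (U ω, V ω) ∈ B} := by
  have : IsProbabilityMeasure (μ.map U) := Measure.isProbabilityMeasure_map hU.aemeasurable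
  have : IsProbabilityMeasure (μ.map V) := Measure.isProbabilityMeasure_map hV.aemeasurable
  have key : ∀ {D : Set (α × β)}, MeasurableSet D →
      μ {ω | (U ω, V ω) ∈ D} = ∫⁻ ω, μ {ω' | (U ω, V ω') ∈ D} ∂μ := by
    intro D hD
    have h1 := (indepFun_iff_map_prod_eq_prod_map_map hU.aemeasurable hV.aemeasurable).1 hUV
    calc μ {ω | (U ω, V ω) ∈ D} = (μ.map fun ω => (U ω, V ω)) D :=
          (Measure.map_apply (hU.prodMk hV) hD).symm
      _ = ∫⁻ u, μ.map V (Prod.mk u ⁻¹' D) ∂(μ.map U) := by rw [h1, Measure.prod_apply hD]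
      _ = ∫⁻ ω, μ.map V (Prod.mk (U ω) ⁻¹' D) ∂μ :=
          lintegral_map (measurable_measure_prodMk_left hD) hU
      _ = _ := lintegral_congr fun ω => Measure.map_apply hV (measurable_prodMk_left hD)
  have hle : μ {ω | (U ω, V ω) ∈ A} ≤ ENNReal.ofReal c * μ {ω | (U ω, V ω) ∈ B} := by
    rw [key hA, key hB, ← lintegral_const_mul' _ _ ENNReal.ofReal_ne_top]
    refine lintegral_mono_ae ?_
    filter_upwards [h] with ω hω
    rw [← ofReal_measureReal, ← ofReal_measureReal (s := {ω' | (U ω, V ω') ∈ B}),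
      ← ENNReal.ofReal_mul hc]
    exact ENNReal.ofReal_le_ofReal hω
  have h2 := ENNReal.toReal_mono (ENNReal.mul_ne_top ENNReal.ofReal_ne_top (measure_ne_top _ _)) hle
  rwa [ENNReal.toReal_mul, ENNReal.toReal_ofReal hc] at h2

/-- Conditionally on the weights, the shift `a` becomes `a / Θ ω ≤ a / ξ` and the threshold `x`
becomes `x / Θ ω ≥ x / δ` (likewise for `Δ`). Both bounds are uniform in the weights, so one
threshold serves almost every section. -/
lemma JointLong.mul [IsProbabilityMeasure μ] {X Y Θ Δ : Ω → ℝ} (h : JointLong μ X Y)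
    (hX : Measurable X) (hY : Measurable Y) (hΘm : Measurable Θ) (hΔm : Measurable Δ)
    (hΘ : AEBoundedAway μ Θ) (hΔ : AEBoundedAway μ Δ)
    (hind : IndepFun (fun ω => (Θ ω, Δ ω)) (fun ω => (X ω, Y ω)) μ) :
    JointLong μ (fun ω => Θ ω * X ω) (fun ω => Δ ω * Y ω) := by
  obtain ⟨ξ, δ, hξ, hδ, hΘ⟩ := hΘ
  obtain ⟨γ, ζ, hγ, hζ, hΔ⟩ := hΔ
  intro a ha ε hε
  obtain ⟨S, hS⟩ := (h (max (a / ξ) (a / γ)) (by positivity) ε hε).exists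
  have hms : ∀ x y : ℝ, MeasurableSet
      {q : (ℝ × ℝ) × (ℝ × ℝ) | x < q.1.1 * q.2.1 ∧ y < q.1.2 * q.2.2} := fun x y =>
    (measurableSet_lt (g := fun q : (ℝ × ℝ) × (ℝ × ℝ) => q.1.1 * q.2.1) measurable_const
      (by fun_prop)).inter
      (measurableSet_lt (g := fun q : (ℝ × ℝ) × (ℝ × ℝ) => q.1.2 * q.2.2) measurable_const
        (by fun_prop))
  filter_upwards [eventually_ge_atTop 0, eventually_ge_atTop (S * δ),
    eventually_ge_atTop (S * ζ)] with T h0 h1 h2 x hx y hy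
  refine measureReal_le_mul_of_sections (hΘm.prodMk hΔm) (hX.prodMk hY) hind
    (hms (x - a) (y - a)) (hms x y) (by positivity) ?_
  filter_upwards [hΘ, hΔ] with ω e1 e2
  have hθ : 0 < Θ ω := hξ.trans_le e1.1
  have hη : 0 < Δ ω := hγ.trans_le e2.1
  have key : ∀ x y : ℝ, μ.real {ω' | x < Θ ω * X ω' ∧ y < Δ ω * Y ω'} =
      jointTail μ X Y (x / Θ ω) (y / Δ ω) := by
    intro x y
    simp only [jointTail, div_lt_iff₀ hθ, div_lt_iff₀ hη, mul_comm]
  rw [key, key]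
  refine (jointTail_anti X Y ?_ ?_).trans (hS (x / Θ ω) ?_ (y / Δ ω) ?_)
  · rw [sub_div]
    have := div_le_div_of_nonneg_left ha.le hξ e1.1
    linarith [le_max_left (a / ξ) (a / γ)]
  · rw [sub_div]
    have := div_le_div_of_nonneg_left ha.le hγ e2.1
    linarith [le_max_right (a / ξ) (a / γ)]
  · exact ((le_div_iff₀ (hξ.trans_le hδ)).2 (h1.trans hx)).trans
      (div_le_div_of_nonneg_left (h0.trans hx) hθ e1.2)
  · exact ((le_div_iff₀ (hγ.trans_le hζ)).2 (h2.trans hy)).trans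
      (div_le_div_of_nonneg_left (h0.trans hy) hη e2.2)

lemma dominatedlyVarying_longTailed_mul [IsProbabilityMeasure μ] {X Θ : Ω → ℝ}
    (h : DominatedlyVarying μ X ∧ LongTailed μ X)
    (hX : Measurable X) (hΘm : Measurable Θ) (hΘ : AEBoundedAway μ Θ) (hind : IndepFun Θ X μ) :
    DominatedlyVarying μ (fun ω => Θ ω * X ω) ∧ LongTailed μ (fun ω => Θ ω * X ω) := by
  obtain ⟨hp, hD⟩ := dominatedlyVarying_iff.1 h.1
  have hL := (longTailed_iff h.1.1).1 h.2
  have hD' : DominatedlyVarying μ (fun ω => Θ ω * X ω) :=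
    dominatedlyVarying_iff.2 ⟨jointTail_mul_pos hΘ hΘ hp, hD.mul hΘ hΘ⟩
  exact ⟨hD', (longTailed_iff hD'.1).2 (hL.mul hX hX hΘm hΘm hΘ hΘ
    (hind.comp (φ := fun t => (t, t)) (ψ := fun t => (t, t)) (by fun_prop) (by fun_prop)))⟩

lemma BivDL.mul [IsProbabilityMeasure μ] {X Y Θ Δ : Ω → ℝ} (h : BivDL μ X Y)
    (hX : Measurable X) (hY : Measurable Y) (hΘm : Measurable Θ) (hΔm : Measurable Δ)
    (hΘ : AEBoundedAway μ Θ) (hΔ : AEBoundedAway μ Δ)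
    (hind : IndepFun (fun ω => (Θ ω, Δ ω)) (fun ω => (X ω, Y ω)) μ) :
    BivDL μ (fun ω => Θ ω * X ω) (fun ω => Δ ω * Y ω) := by
  obtain ⟨h1, h2, h3, h4, h5⟩ := bivDL_iff.1 h
  exact bivDL_iff.2
    ⟨dominatedlyVarying_longTailed_mul h1 hX hΘm hΘ (hind.comp measurable_fst measurable_fst),
      dominatedlyVarying_longTailed_mul h2 hY hΔm hΔ (hind.comp measurable_snd measurable_snd),
      jointTail_mul_pos hΘ hΔ h3, h4.mul hΘ hΔ, h5.mul hX hY hΘm hΔm hΘ hΔ hind⟩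

/-! ### One big jump in each coordinate -/

/-- `Z k` and `W l` exceed their thresholds but some other term is larger than `a` in modulus. -/
def crowded {n : ℕ} (Z W : Fin n → Ω → ℝ) (k l : Fin n) (a x y : ℝ) : Set Ω :=
  {ω | (x < Z k ω ∧ y < W l ω) ∧
    ((∃ i, i ≠ k ∧ a < |Z i ω|) ∨ ∃ j, j ≠ l ∧ a < |W j ω|)}

/-- A functional of `Z` that is comparable with each single term when the others are small. -/
structure SingleJump {n : ℕ} (Z : Fin n → Ω → ℝ) (U : Ω → ℝ) : Prop where
  le_sum_posPart : ∀ ω, U ω ≤ ∑ k, max (Z k ω) 0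
  term_le : ∀ ω (a : ℝ) (k : Fin n), 0 ≤ a → (∀ i, i ≠ k → |Z i ω| ≤ a) → Z k ω ≤ U ω + n * a

lemma measurableSet_crowded {n : ℕ} {Z W : Fin n → Ω → ℝ} (hZ : ∀ k, Measurable (Z k))
    (hW : ∀ l, Measurable (W l)) (k l : Fin n) (a x y : ℝ) :
    MeasurableSet (crowded Z W k l a x y) := by
  have h : ∀ V : Fin n → Ω → ℝ, (∀ i, Measurable (V i)) → ∀ k : Fin n,
      MeasurableSet {ω | ∃ i, i ≠ k ∧ a < |V i ω|} := by
    intro V hV k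
    have : {ω | ∃ i, i ≠ k ∧ a < |V i ω|} = ⋃ i, {ω | i ≠ k ∧ a < |V i ω|} := by ext; simp
    rw [this]
    exact MeasurableSet.iUnion fun i =>
      (MeasurableSet.const _).inter (measurableSet_lt measurable_const (hV i).abs)
  exact ((measurableSet_lt measurable_const (hZ k)).inter
    (measurableSet_lt measurable_const (hW l))).inter ((h Z hZ k).union (h W hW l))

/-- Union bound over at most `2 * n` events, each given the share `ε / (2 * n)`. -/
lemma eventually_crowded_le [IsFiniteMeasure μ] {n : ℕ} {Z W : Fin n → Ω → ℝ}
    (hZ : ∀ i k l, i ≠ k → Negligible μ (Z i) (Z k) (W l))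
    (hW : ∀ j l k, j ≠ l → Negligible μ (W j) (Z k) (W l)) (k l : Fin n) {ε : ℝ} (hε : 0 < ε) :
    ∀ᶠ T : ℝ in atTop, ∀ a ≥ T, ∀ x ≥ T, ∀ y ≥ T,
      μ.real (crowded Z W k l a x y) ≤ ε * jointTail μ (Z k) (W l) x y := by
  have hn : (0 : ℝ) < n := by exact_mod_cast k.pos
  have hε' : 0 < ε / (2 * n) := by positivity
  have h1 : ∀ᶠ T : ℝ in atTop, ∀ i, i ≠ k → ∀ a ≥ T, ∀ x ≥ T, ∀ y ≥ T,
      μ.real ({ω | x < Z k ω ∧ y < W l ω} ∩ {ω | a < |Z i ω|}) ≤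
        ε / (2 * n) * jointTail μ (Z k) (W l) x y :=
    eventually_all.2 fun i => eventually_imp_distrib_left.2 fun hi => hZ i k l hi _ hε'
  have h2 : ∀ᶠ T : ℝ in atTop, ∀ j, j ≠ l → ∀ a ≥ T, ∀ x ≥ T, ∀ y ≥ T,
      μ.real ({ω | x < Z k ω ∧ y < W l ω} ∩ {ω | a < |W j ω|}) ≤
        ε / (2 * n) * jointTail μ (Z k) (W l) x y :=
    eventually_all.2 fun j => eventually_imp_distrib_left.2 fun hj => hW j l k hj _ hε'
  filter_upwards [h1, h2] with T h1 h2 a ha x hx y hy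
  have bound : ∀ (V : Fin n → Ω → ℝ) (m : Fin n), (∀ i, i ≠ m →
      μ.real ({ω | x < Z k ω ∧ y < W l ω} ∩ {ω | a < |V i ω|}) ≤
        ε / (2 * n) * jointTail μ (Z k) (W l) x y) →
      μ.real (⋃ i ∈ Finset.univ.filter (· ≠ m),
        ({ω | x < Z k ω ∧ y < W l ω} ∩ {ω | a < |V i ω|})) ≤
        ε / 2 * jointTail μ (Z k) (W l) x y := by
    intro V m hV
    refine (measureReal_biUnion_finset_le _ _).trans ?_
    refine (Finset.sum_le_sum fun i hi => hV i (by simpa using hi)).trans ?_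
    rw [Finset.sum_const, nsmul_eq_mul]
    have hcard : ((Finset.univ.filter (· ≠ m)).card : ℝ) ≤ n := by
      exact_mod_cast (Finset.card_filter_le _ _).trans (by simp)
    calc _ ≤ (n : ℝ) * (ε / (2 * n) * jointTail μ (Z k) (W l) x y) :=
          mul_le_mul_of_nonneg_right hcard
            (mul_nonneg hε'.le (jointTail_nonneg _ _ _ _))
      _ = _ := by field_simp
  calc μ.real (crowded Z W k l a x y)
      ≤ μ.real ((⋃ i ∈ Finset.univ.filter (· ≠ k),
          ({ω | x < Z k ω ∧ y < W l ω} ∩ {ω | a < |Z i ω|})) ∪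
        ⋃ j ∈ Finset.univ.filter (· ≠ l),
          ({ω | x < Z k ω ∧ y < W l ω} ∩ {ω | a < |W j ω|})) := by
        refine measureReal_mono ?_
        rintro ω ⟨hω, ⟨i, hi, hi'⟩ | ⟨j, hj, hj'⟩⟩
        · exact Or.inl (Set.mem_biUnion (x := i) (by simpa using hi) ⟨hω, hi'⟩)
        · exact Or.inr (Set.mem_biUnion (x := j) (by simpa using hj) ⟨hω, hj'⟩)
    _ ≤ _ := measureReal_union_le _ _
    _ ≤ ε / 2 * jointTail μ (Z k) (W l) x y + ε / 2 * jointTail μ (Z k) (W l) x y :=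
        add_le_add (bound Z k fun i hi => h1 i hi a ha x hx y hy)
          (bound W l fun j hj => h2 j hj a ha x hx y hy)
    _ = _ := by ring

/-- Pigeonhole on positive parts. The index is chosen before `a`, so the same `k` serves in the
crowded and the uncrowded case. -/
lemma exists_lt_and_sub_lt_of_lt_sum {n : ℕ} {z : Fin n → ℝ} {x : ℝ} (hx : 0 ≤ x)
    (h : x < ∑ k, max (z k) 0) :
    ∃ k, x / n < z k ∧ ∀ a, 0 ≤ a → (∀ i, i ≠ k → |z i| ≤ a) → x - n * a < z k := by
  have hn : (0 : ℝ) < n := by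
    rcases Nat.eq_zero_or_pos n with rfl | hn
    · simp at h; linarith
    · exact_mod_cast hn
  have h' : ∑ _k : Fin n, x / n < ∑ k, max (z k) 0 := by
    rw [Finset.sum_const, Finset.card_univ, Fintype.card_fin, nsmul_eq_mul,
      mul_div_cancel₀ _ hn.ne']
    exact h
  obtain ⟨k, -, hk⟩ := Finset.exists_lt_of_sum_lt h'
  have hxn : 0 ≤ x / n := by positivity
  have hk' : x / n < z k := (lt_max_iff.1 hk).resolve_right (not_lt.2 hxn)
  refine ⟨k, hk', fun a ha hi => ?_⟩
  have hsum : ∑ i, max (z i) 0 ≤ z k + n * a := by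
    rw [← Finset.add_sum_erase _ _ (Finset.mem_univ k), max_eq_left (hxn.trans hk'.le)]
    gcongr
    refine (Finset.sum_le_card_nsmul _ _ a fun i hi' =>
      max_le ((le_abs_self _).trans (hi i (Finset.ne_of_mem_erase hi'))) ha).trans ?_
    rw [nsmul_eq_mul]
    refine mul_le_mul_of_nonneg_right ?_ ha
    exact_mod_cast (Finset.card_erase_le).trans (by simp)
  linarith

lemma eventually_jointTail_le [IsFiniteMeasure μ] {n : ℕ} {Z W : Fin n → Ω → ℝ}
    (hZ : ∀ i k l, i ≠ k → Negligible μ (Z i) (Z k) (W l))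
    (hW : ∀ j l k, j ≠ l → Negligible μ (W j) (Z k) (W l))
    (hD : ∀ k l, JointDom μ (Z k) (W l)) (hL : ∀ k l, JointLong μ (Z k) (W l))
    {U V : Ω → ℝ} (hU : ∀ ω, U ω ≤ ∑ k, max (Z k ω) 0) (hV : ∀ ω, V ω ≤ ∑ l, max (W l ω) 0)
    {ε : ℝ} (hε : 0 < ε) :
    ∀ᶠ T : ℝ in atTop, ∀ x ≥ T, ∀ y ≥ T,
      jointTail μ U V x y ≤ (1 + 2 * ε) * ∑ k, ∑ l, jointTail μ (Z k) (W l) x y := by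
  rcases Nat.eq_zero_or_pos n with rfl | hn
  · filter_upwards [eventually_ge_atTop 0] with T hT x hx y hy
    have : {ω | x < U ω ∧ y < V ω} = ∅ := by
      ext ω
      have := hU ω
      simp only [Finset.univ_eq_empty, Finset.sum_empty] at this
      simp only [Set.mem_ofPred_eq, Set.mem_empty_iff_false, iff_false, not_and]
      intro h; linarith [hT.trans hx]
    simp [jointTail, this]
  have hn0 : (0 : ℝ) < n := by exact_mod_cast hn
  -- The order of quantifiers matters: `a` is fixed first and does not grow with `x` and `y`, so the
  -- later shift `n * a` is a constant.
  have hcr : ∀ k l, ∀ᶠ a : ℝ in atTop, ∀ᶠ T : ℝ in atTop, ∀ x ≥ T, ∀ y ≥ T,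
      μ.real (crowded Z W k l a (x / n) (y / n)) ≤ ε * jointTail μ (Z k) (W l) x y := by
    intro k l
    obtain ⟨C, hC, h1⟩ := (hD k l).rescale hn0 hn0 one_pos one_pos
    obtain ⟨S, hS⟩ := (eventually_crowded_le hZ hW k l (div_pos hε hC)).exists
    filter_upwards [eventually_ge_atTop S] with a ha
    filter_upwards [h1, eventually_ge_atTop (S * n)] with T h1 h2 x hx y hy
    calc _ ≤ ε / C * jointTail μ (Z k) (W l) (x / n) (y / n) :=
          hS a ha _ ((le_div_iff₀ hn0).2 (h2.trans hx)) _ ((le_div_iff₀ hn0).2 (h2.trans hy))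
      _ ≤ ε / C * (C * jointTail μ (Z k) (W l) (x / 1) (y / 1)) :=
          mul_le_mul_of_nonneg_left (h1 x hx y hy) (by positivity)
      _ = _ := by rw [div_one, div_one]; field_simp
  obtain ⟨a, ha, ha0⟩ := ((eventually_all.2 fun k => eventually_all.2 fun l => hcr k l).and
    (eventually_gt_atTop 0)).exists
  have hlong := eventually_all.2 fun k => eventually_all.2 fun l =>
    hL k l (n * a) (by positivity) ε hε
  have hcr' := eventually_all.2 fun k => eventually_all.2 fun l => ha k l
  filter_upwards [hlong, hcr', eventually_ge_atTop 0] with T h1 h2 h0 x hx y hy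
  calc jointTail μ U V x y
      ≤ μ.real (⋃ p ∈ (Finset.univ : Finset (Fin n × Fin n)),
          ({ω | x - n * a < Z p.1 ω ∧ y - n * a < W p.2 ω} ∪
            crowded Z W p.1 p.2 a (x / n) (y / n))) := by
        refine measureReal_mono (fun ω hω => ?_) (measure_ne_top _ _)
        obtain ⟨k, hk, hk'⟩ := exists_lt_and_sub_lt_of_lt_sum (h0.trans hx)
          (hω.1.trans_le (hU ω))
        obtain ⟨l, hl, hl'⟩ := exists_lt_and_sub_lt_of_lt_sum (h0.trans hy)
          (hω.2.trans_le (hV ω))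
        refine Set.mem_biUnion (x := (k, l)) (Finset.mem_coe.2 (Finset.mem_univ _)) ?_
        by_cases hc : (∃ i, i ≠ k ∧ a < |Z i ω|) ∨ ∃ j, j ≠ l ∧ a < |W j ω|
        · exact Or.inr ⟨⟨hk, hl⟩, hc⟩
        · push Not at hc
          exact Or.inl ⟨hk' a ha0.le hc.1, hl' a ha0.le hc.2⟩
    _ ≤ ∑ p : Fin n × Fin n, μ.real ({ω | x - n * a < Z p.1 ω ∧ y - n * a < W p.2 ω} ∪
            crowded Z W p.1 p.2 a (x / n) (y / n)) := measureReal_biUnion_finset_le _ _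
    _ ≤ ∑ p : Fin n × Fin n, (1 + 2 * ε) * jointTail μ (Z p.1) (W p.2) x y := by
        refine Finset.sum_le_sum fun p _ => (measureReal_union_le _ _).trans ?_
        have e1 := h1 p.1 p.2 x hx y hy
        have e2 := h2 p.1 p.2 x hx y hy
        simp only [jointTail] at e1 e2 ⊢
        linarith
    _ = _ := by rw [← Finset.mul_sum, Fintype.sum_prod_type]

/-- Thresholds are raised by `n * a` to offset the loss in `term_le`. On the uncrowded events both
functionals then exceed `x` and `y`, and disjointness turns the sum of probabilities into the
probability of a union. -/
lemma eventually_le_jointTail [IsFiniteMeasure μ] {n : ℕ} {Z W : Fin n → Ω → ℝ}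
    (hZm : ∀ k, Measurable (Z k)) (hWm : ∀ l, Measurable (W l))
    (hZ : ∀ i k l, i ≠ k → Negligible μ (Z i) (Z k) (W l))
    (hW : ∀ j l k, j ≠ l → Negligible μ (W j) (Z k) (W l))
    (hL : ∀ k l, JointLong μ (Z k) (W l))
    {U V : Ω → ℝ} (hU : SingleJump Z U) (hV : SingleJump W V) {ε : ℝ} (hε : 0 < ε) :
    ∀ᶠ T : ℝ in atTop, ∀ x ≥ T, ∀ y ≥ T,
      (1 - 2 * ε) * ∑ k, ∑ l, jointTail μ (Z k) (W l) x y ≤ jointTail μ U V x y := by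
  obtain ⟨a, ha, ha0⟩ := ((eventually_all.2 fun k => eventually_all.2 fun l =>
    eventually_crowded_le hZ hW k l hε).and (eventually_gt_atTop 0)).exists
  have hna : 0 ≤ n * a := by positivity
  -- The extra 1 keeps the shift positive even if `n = 0`.
  have hlong := eventually_all.2 fun k => eventually_all.2 fun l =>
    hL k l (n * a + 1) (by positivity) ε hε
  filter_upwards [hlong, eventually_ge_atTop a] with T h1 h2 x hx y hy
  set G : Fin n × Fin n → Set Ω := fun p =>
    {ω | x + n * a < Z p.1 ω ∧ y + n * a < W p.2 ω} \
      crowded Z W p.1 p.2 a (x + n * a) (y + n * a) with hG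
  have hmem : ∀ p ω, ω ∈ G p → (x + n * a < Z p.1 ω ∧ y + n * a < W p.2 ω) ∧
      (∀ i, i ≠ p.1 → |Z i ω| ≤ a) ∧ ∀ j, j ≠ p.2 → |W j ω| ≤ a := by
    rintro p ω ⟨hω, hω'⟩
    refine ⟨hω, ?_⟩
    have hc : ¬((∃ i, i ≠ p.1 ∧ a < |Z i ω|) ∨ ∃ j, j ≠ p.2 ∧ a < |W j ω|) :=
      fun hc => hω' ⟨hω, hc⟩
    push Not at hc
    exact hc
  have hdisj : Set.PairwiseDisjoint ((Finset.univ : Finset (Fin n × Fin n)) : Set _) G := by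
    intro p _ q _ hpq
    refine Set.disjoint_left.2 fun ω hp hq => hpq ?_
    have h3 := hmem p ω hp
    have h4 := hmem q ω hq
    refine Prod.ext ?_ ?_
    · by_contra hne
      -- The term `Z p.1` would be both above `x + n * a ≥ a` and at most `a`.
      linarith [h3.1.1, h4.2.1 p.1 hne, le_abs_self (Z p.1 ω)]
    · by_contra hne
      linarith [h3.1.2, h4.2.2 p.2 hne, le_abs_self (W p.2 ω)]
  have hGm : ∀ p, MeasurableSet (G p) := fun p =>
    ((measurableSet_lt measurable_const (hZm _)).inter
      (measurableSet_lt measurable_const (hWm _))).diff (measurableSet_crowded hZm hWm _ _ _ _ _)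
  calc (1 - 2 * ε) * ∑ k, ∑ l, jointTail μ (Z k) (W l) x y
      = ∑ p : Fin n × Fin n, (1 - 2 * ε) * jointTail μ (Z p.1) (W p.2) x y := by
        rw [← Finset.mul_sum, Fintype.sum_prod_type]
    _ ≤ ∑ p : Fin n × Fin n, μ.real (G p) := by
        refine Finset.sum_le_sum fun p _ => ?_
        have e1 := h1 p.1 p.2 (x + n * a + 1) (by linarith) (y + n * a + 1) (by linarith)
        have e2 := ha p.1 p.2 a le_rfl (x + n * a) (by linarith) (y + n * a) (by linarith)
        have e3 : jointTail μ (Z p.1) (W p.2) (x + n * a) (y + n * a) -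
            μ.real (crowded Z W p.1 p.2 a (x + n * a) (y + n * a)) ≤ μ.real (G p) :=
          le_measureReal_sdiff
        have e4 := jointTail_anti (μ := μ) (Z p.1) (W p.2)
          (show x + n * a ≤ x + n * a + 1 by linarith) (show y + n * a ≤ y + n * a + 1 by linarith)
        have e5 := jointTail_anti (μ := μ) (Z p.1) (W p.2)
          (show x ≤ x + n * a by linarith) (show y ≤ y + n * a by linarith)
        rw [show x + n * a + 1 - (n * a + 1) = x by ring,
          show y + n * a + 1 - (n * a + 1) = y by ring] at e1
        -- One `ε` is lost in raising the thresholds, the other in removing the crowded event.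
        nlinarith [jointTail_nonneg (μ := μ) (Z p.1) (W p.2) x y]
    _ = μ.real (⋃ p ∈ (Finset.univ : Finset (Fin n × Fin n)), G p) :=
        (measureReal_biUnion_finset hdisj fun p _ => hGm p).symm
    _ ≤ jointTail μ U V x y := by
        refine measureReal_mono ?_
        intro ω hω
        simp only [Finset.mem_univ, Set.iUnion_true, Set.mem_iUnion] at hω
        obtain ⟨p, hp⟩ := hω
        have h3 := hmem p ω hp
        exact ⟨by linarith [h3.1.1, hU.term_le ω a p.1 ha0.le h3.2.1],
          by linarith [h3.1.2, hV.term_le ω a p.2 ha0.le h3.2.2]⟩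

theorem SingleJump.jointTailEquivDoubleSum [IsFiniteMeasure μ] {n : ℕ} {Z W : Fin n → Ω → ℝ}
    (hZm : ∀ k, Measurable (Z k)) (hWm : ∀ l, Measurable (W l))
    (hZ : ∀ i k l, i ≠ k → Negligible μ (Z i) (Z k) (W l))
    (hW : ∀ j l k, j ≠ l → Negligible μ (W j) (Z k) (W l))
    (hD : ∀ k l, JointDom μ (Z k) (W l)) (hL : ∀ k l, JointLong μ (Z k) (W l))
    {U V : Ω → ℝ} (hU : SingleJump Z U) (hV : SingleJump W V) :
    JointTailEquivDoubleSum μ U V Z W := by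
  refine isLittleO_iff.2 fun c hc => ?_
  have h1 := eventually_jointTail_le hZ hW hD hL hU.le_sum_posPart hV.le_sum_posPart (half_pos hc)
  have h2 := eventually_le_jointTail hZm hWm hZ hW hL hU hV (half_pos hc)
  rw [eventually_atTop_prod_iff]
  filter_upwards [h1, h2] with T h1 h2 x hx y hy
  have e1 := h1 x hx y hy
  have e2 := h2 x hx y hy
  have hnn : 0 ≤ ∑ k, ∑ l, jointTail μ (Z k) (W l) x y :=
    Finset.sum_nonneg fun _ _ => Finset.sum_nonneg fun _ _ => jointTail_nonneg _ _ _ _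
  simp only [Pi.sub_apply, Real.norm_eq_abs]
  rw [abs_of_nonneg hnn, abs_le]
  constructor <;> linarith

/-! ### The three single-jump functionals -/

lemma singleJump_totalSum {Ω : Type*} {n : ℕ} (Z : Fin n → Ω → ℝ) : SingleJump Z (totalSum Z) where
  le_sum_posPart _ := Finset.sum_le_sum fun _ _ => le_max_left _ _
  term_le ω a k ha h := by
    have h1 : ∑ i ∈ Finset.univ.erase k, -a ≤ ∑ i ∈ Finset.univ.erase k, Z i ω :=
      Finset.sum_le_sum fun i hi => (abs_le.1 (h i (Finset.ne_of_mem_erase hi))).1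
    have h2 : ((Finset.univ.erase k).card : ℝ) ≤ n := by
      exact_mod_cast (Finset.card_erase_le).trans (by simp)
    rw [Finset.sum_const, nsmul_eq_mul] at h1
    rw [totalSum, ← Finset.add_sum_erase _ _ (Finset.mem_univ k)]
    nlinarith

lemma singleJump_maxTerm {Ω : Type*} {n : ℕ} [NeZero n] (Z : Fin n → Ω → ℝ) :
    SingleJump Z (maxTerm Z) where
  le_sum_posPart ω := Finset.sup'_le Finset.univ_nonempty _ fun k _ => (le_max_left _ _).trans
    (Finset.single_le_sum (f := fun k => max (Z k ω) 0) (fun _ _ => le_max_right _ _)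
      (Finset.mem_univ k))
  term_le ω a k ha _ := by
    have h1 : Z k ω ≤ maxTerm Z ω :=
      Finset.le_sup' (fun k => Z k ω) (Finset.mem_univ k)
    have : 0 ≤ n * a := by positivity
    linarith

/-- Every partial sum is at most the full sum of positive parts, and the last partial sum is the
total sum, whose lower bound is inherited. -/
lemma singleJump_maxPartialSum {Ω : Type*} {n : ℕ} [NeZero n] (Z : Fin n → Ω → ℝ) :
    SingleJump Z (maxPartialSum Z) where
  le_sum_posPart ω := Finset.sup'_le Finset.univ_nonempty _ fun i _ =>
    (Finset.sum_le_sum fun _ _ => le_max_left _ _).trans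
      (Finset.sum_le_sum_of_subset_of_nonneg (Finset.subset_univ _) fun _ _ _ => le_max_right _ _)
  term_le ω a k ha h := by
    have h1 : totalSum Z ω ≤ maxPartialSum Z ω := by
      have h2 : ∑ k ∈ Finset.Iic (⊤ : Fin n), Z k ω ≤ maxPartialSum Z ω :=
        Finset.le_sup' (fun i : Fin n => ∑ k ∈ Finset.Iic i, Z k ω) (Finset.mem_univ ⊤)
      rwa [Finset.Iic_top] at h2
    linarith [(singleJump_totalSum Z).term_le ω a k ha h]

end TailAsymptotics

theorem mainTheorem2 {Ω : Type*} [MeasurableSpace Ω] (μ : Measure Ω) [IsProbabilityMeasure μ]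
    (n : ℕ) [NeZero n] (X Y Θ Δ : Fin n → Ω → ℝ)
    (hX : ∀ k, Measurable (X k)) (hY : ∀ l, Measurable (Y l))
    (hΘ : ∀ k, Measurable (Θ k)) (hΔ : ∀ l, Measurable (Δ l))
    (hXDL : ∀ k, DominatedlyVarying μ (X k) ∧ LongTailed μ (X k))
    (hYDL : ∀ l, DominatedlyVarying μ (Y l) ∧ LongTailed μ (Y l))
    (hGTAI : GTAI μ X Y)
    (hXY : ∀ k l, BivDL μ (X k) (Y l))
    (hΘb : ∀ k, AEBoundedAway μ (Θ k)) (hΔb : ∀ l, AEBoundedAway μ (Δ l))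
    (hindep : IndepFun (fun ω => ((fun k => Θ k ω), (fun l => Δ l ω)))
      (fun ω => ((fun k => X k ω), (fun l => Y l ω))) μ) :
    GTAI μ (weighted Θ X) (weighted Δ Y) ∧
    (∀ k l, BivDL μ (weighted Θ X k) (weighted Δ Y l)) ∧
    (TAI μ X → TAI μ Y →
      JointTailEquivDoubleSum μ (totalSum (weighted Θ X)) (totalSum (weighted Δ Y))
        (weighted Θ X) (weighted Δ Y) ∧
      JointTailEquivDoubleSum μ (maxPartialSum (weighted Θ X)) (maxPartialSum (weighted Δ Y))
        (weighted Θ X) (weighted Δ Y) ∧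
      JointTailEquivDoubleSum μ (maxTerm (weighted Θ X)) (maxTerm (weighted Δ Y))
        (weighted Θ X) (weighted Δ Y)) := by
  have hZm : ∀ k, Measurable (weighted Θ X k) := fun k => (hΘ k).mul (hX k)
  have hWm : ∀ l, Measurable (weighted Δ Y l) := fun l => (hΔ l).mul (hY l)
  have hBiv : ∀ k l, BivDL μ (weighted Θ X k) (weighted Δ Y l) := fun k l =>
    (hXY k l).mul (hX k) (hY l) (hΘ k) (hΔ l) (hΘb k) (hΔb l)
      (hindep.comp (φ := fun q => (q.1 k, q.2 l)) (ψ := fun q => (q.1 k, q.2 l))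
        (by fun_prop) (by fun_prop))
  have hpos : ∀ k l x y, 0 < jointTail μ (X k) (Y l) x y := fun k l => (hXY k l).1.2.2.1
  have hD : ∀ k l, JointDom μ (X k) (Y l) := fun k l => (bivDL_iff.1 (hXY k l)).2.2.2.1
  have hZ : ∀ i k l, i ≠ k → Negligible μ (weighted Θ X i) (weighted Θ X k) (weighted Δ Y l) :=
    fun i k l hik => ((negligible_iff (hX k) (hY l) (hpos k l)).1 (hGTAI.1 i k l hik)).mul
      (hD k l) (hΘb i) (hΘb k) (hΔb l)
  have hW : ∀ j l k, j ≠ l → Negligible μ (weighted Δ Y j) (weighted Θ X k) (weighted Δ Y l) :=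
    fun j l k hjl => ((negligible_iff (hX k) (hY l) (hpos k l)).1 (hGTAI.2 j l k hjl)).mul
      (hD k l) (hΔb j) (hΘb k) (hΔb l)
  have hpos' : ∀ k l x y, 0 < jointTail μ (weighted Θ X k) (weighted Δ Y l) x y :=
    fun k l => (hBiv k l).1.2.2.1
  have hD' := fun k l => (bivDL_iff.1 (hBiv k l)).2.2.2.1
  have hL' := fun k l => (bivDL_iff.1 (hBiv k l)).2.2.2.2
  refine ⟨⟨fun i k l hik => (negligible_iff (hZm k) (hWm l) (hpos' k l)).2 (hZ i k l hik),
    fun j l k hjl => (negligible_iff (hZm k) (hWm l) (hpos' k l)).2 (hW j l k hjl)⟩,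
    hBiv, fun _ _ => ⟨?_, ?_, ?_⟩⟩
  -- All three tails are compared with the same double sum, which links them into the stated chain
  -- of equivalences.
  · exact SingleJump.jointTailEquivDoubleSum hZm hWm hZ hW hD' hL'
      (singleJump_totalSum _) (singleJump_totalSum _)
  · exact SingleJump.jointTailEquivDoubleSum hZm hWm hZ hW hD' hL'
      (singleJump_maxPartialSum _) (singleJump_maxPartialSum _)
  · exact SingleJump.jointTailEquivDoubleSum hZm hWm hZ hW hD' hL'
      (singleJump_maxTerm _) (singleJump_maxTerm _)
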